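/- **Setting.** Let $n\ge 3$ and let $\lambda$ be a symmetric (permutation-invariant, otherwise arbitrarily correlated) probability distribution on click-outcome profiles $\vec o\in\{0,1\}^n$. Write $\lambda_k=\Pr_{\vec o\sim\lambda}[\|\vec o\|_1=k]$ and assume $\lambda_0>0$. A signaling $\pi$ assigns to every $\vec o$ a Borel probability distribution $\pi(\cdot\mid\vec o)$ on $[0,1]^n$; the signals of different bidders may be arbitrarily correlated. It is *calibrated* if, for $\vec o\sim\lambda$ and $\vec x\sim\pi(\cdot\mid\vec o)$, $\mathbb E[o_i\mid x_i]=x_i$ almost surely for every $i\in[n]$. Its revenue is $\mathrm{Rev}(\pi)=\mathbb E[\mathrm{secmax}(\vec x)]$, where $\mathrm{secmax}(\vec x)$ is the second-highest entry of $\vec x$, counted with multiplicity. A calibrated signaling $\pi^\star$ is *optimal* if $\mathrm{Rev}(\pi^\star)\ge\mathrm{Rev}(\pi)$ for every calibrated $\pi$. Let $W=\sum_{k=1}^n\lambda_k$ be the maximum welfare. Let $(h_k,l_k)_{2\le k\le n}$ be any solution of the linear system $$l_n>0,\qquad h_k,l_k\ge 0,\qquad h_k+l_k=\tfrac{k-2}{k}\quad(2\le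 k\le n),$$ $$\sum_{k=2}^n\lambda_k k h_k=\max\left\{\frac{\lambda_1\sum_{k=2}^n(k-2)\lambda_k+2\lambda_1\lambda_0(1-\sqrt2)}{\lambda_1+\sqrt2\,\lambda_0},\,0\right\},$$ $$\sum_{k=2}^n\lambda_k k h_k+\sum_{k=2}^n\lambda_k k l_k=\sum_{k=2}^n(k-2)\lambda_k,$$ and put $$t_1^\star=\frac{\lambda_1+\sum_{k=2}^n\lambda_k k h_k}{2\lambda_1+\sum_{k=2}^n\lambda_k k h_k},\qquad t_0^\star=\frac{\sum_{k=2}^n\lambda_k k l_k}{2\lambda_0+\sum_{k=2}^n\lambda_k k l_k}.$$ (If $\lambda_1=0$ the first quotient is $0/0$; then put $t_1^\star=0$. In that case $t_1^\star$ occurs below only multiplied by $\lambda_1=0$, so its value is immaterial.) **Corollary.** An optimal calibrated signaling exists, the linear system has a solution, and for every solution of the system and every optimal calibrated signaling $\pi^\star$, $$\mathrm{Rev}(\pi^\star)=\lambda_0t_0^\star+\lambda_1t_1^\star+\sum_{k=2}^n\lambda_k .$$ Moreover: - if $t_0^\star\le\lambda_1(1-t_1^\star)/\lambda_0$, then $\mathrm{Rev}(\pi^\star)\le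 W$, with equality if and only if $t_0^\star=\lambda_1(1-t_1^\star)/\lambda_0$; - if $t_0^\star>\lambda_1(1-t_1^\star)/\lambda_0$, then $\mathrm{Rev}(\pi^\star)>W$. -/

import Mathlib

open MeasureTheory
open scoped BigOperators

noncomputable section

namespace CalibratedSignaling

/-- Click-outcome profiles `o ∈ {0,1}^n` (`true` means that a click is realized). -/
abbrev Outcome (n : ℕ) : Type := Fin n → Bool

/-- Bid (= signal) profiles `x ∈ [0,1]^n`. -/
abbrev BidProfile (n : ℕ) : Type := Fin n → unitInterval

/-- The outcome `o_i ∈ {0,1}` of bidder `i`, as a real number. -/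
def click {n : ℕ} (o : Outcome n) (i : Fin n) : ℝ := if o i = true then 1 else 0

/-- The `ℓ₁`-norm of an outcome profile, i.e. its number of clicks. -/
def clicks {n : ℕ} (o : Outcome n) : ℕ := (Finset.univ.filter fun i => o i = true).card

/-- `lam` is a symmetric probability distribution on outcome profiles; the correlation
across bidders is otherwise arbitrary. -/
structure IsSymmetricPrior {n : ℕ} (lam : Outcome n → ℝ) : Prop where
  nonneg : ∀ o, 0 ≤ lam o
  sum_eq_one : ∑ o, lam o = 1
  symm : ∀ (σ : Equiv.Perm (Fin n)) (o : Outcome n), lam (fun i => o (σ i)) = lam o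

/-- `λ_k`, the prior probability that exactly `k` bidders have outcome `1`. -/
def levelMass {n : ℕ} (lam : Outcome n → ℝ) (k : ℕ) : ℝ :=
  ∑ o ∈ Finset.univ.filter (fun o : Outcome n => clicks o = k), lam o

/-- The maximum welfare `∑_{k=1}^n λ_k`. -/
def welfare {n : ℕ} (lam : Outcome n → ℝ) : ℝ := ∑ k ∈ Finset.Icc 1 n, levelMass lam k

/-- A signaling: conditionally on each outcome profile, a Borel probability distribution of the
signal profile in `[0,1]^n`. Signals of different bidders may be arbitrarily correlated; a
signaling with signal sets `X_i ⊆ [0,1]` is one whose distributions are carried by `∏ X_i`. -/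
abbrev Signaling (n : ℕ) : Type := Outcome n → ProbabilityMeasure (BidProfile n)

/-- The joint law of `(o, x)` with `o ∼ lam` and `x ∼ π(· ∣ o)`. -/
def jointLaw {n : ℕ} (lam : Outcome n → ℝ) (π : Signaling n) :
    Measure (Outcome n × BidProfile n) :=
  ∑ o, ENNReal.ofReal (lam o) •
    (Measure.dirac o).prod (π o : Measure (BidProfile n))

/-- Calibration: `E[o_i ∣ x_i] = x_i` almost surely, for every bidder `i`. -/
def IsCalibrated {n : ℕ} (lam : Outcome n → ℝ) (π : Signaling n) : Prop :=
  ∀ i : Fin n,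
    condExp (MeasurableSpace.comap (fun p : Outcome n × BidProfile n => p.2 i) inferInstance)
        (jointLaw lam π) (fun p => click p.1 i)
      =ᵐ[jointLaw lam π] fun p => (p.2 i : ℝ)

/-- The second-highest entry of `x`, counted with multiplicity: the largest value that is attained
or exceeded at two different positions (meaningful for `n ≥ 2`). -/
def secmax {n : ℕ} (x : Fin n → ℝ) : ℝ :=
  ⨆ p : {p : Fin n × Fin n // p.1 ≠ p.2}, min (x p.1.1) (x p.1.2)

/-- Expected second-highest bid when every bidder bids his signal. -/
def revenue {n : ℕ} (lam : Outcome n → ℝ) (π : Signaling n) : ℝ :=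
  ∫ p, secmax (fun i => (p.2 i : ℝ)) ∂(jointLaw lam π)

/-- An optimal calibrated signaling. -/
def IsOptimalCalibrated {n : ℕ} (lam : Outcome n → ℝ) (π : Signaling n) : Prop :=
  IsCalibrated lam π ∧ ∀ π' : Signaling n, IsCalibrated lam π' → revenue lam π' ≤ revenue lam π

/-- The linear system in the unknowns `(h_k, l_k)`, `2 ≤ k ≤ n`. -/
structure LinSys {n : ℕ} (lam : Outcome n → ℝ) (h l : ℕ → ℝ) : Prop where
  low_pos : 0 < l n
  high_nonneg : ∀ k ∈ Finset.Icc 2 n, 0 ≤ h k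
  low_nonneg : ∀ k ∈ Finset.Icc 2 n, 0 ≤ l k
  add_eq : ∀ k ∈ Finset.Icc 2 n, h k + l k = ((k : ℝ) - 2) / k
  high_sum : ∑ k ∈ Finset.Icc 2 n, levelMass lam k * (k * h k) =
    max ((levelMass lam 1 * ∑ k ∈ Finset.Icc 2 n, ((k : ℝ) - 2) * levelMass lam k
          + 2 * levelMass lam 1 * levelMass lam 0 * (1 - Real.sqrt 2)) /
        (levelMass lam 1 + Real.sqrt 2 * levelMass lam 0)) 0
  total_sum : ∑ k ∈ Finset.Icc 2 n, levelMass lam k * (k * h k)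
      + ∑ k ∈ Finset.Icc 2 n, levelMass lam k * (k * l k) =
    ∑ k ∈ Finset.Icc 2 n, ((k : ℝ) - 2) * levelMass lam k

/-- `t*_1`, computed from the `h`-part of a solution of the linear system. -/
def tOne {n : ℕ} (lam : Outcome n → ℝ) (h : ℕ → ℝ) : ℝ :=
  (levelMass lam 1 + ∑ k ∈ Finset.Icc 2 n, levelMass lam k * (k * h k)) /
    (2 * levelMass lam 1 + ∑ k ∈ Finset.Icc 2 n, levelMass lam k * (k * h k))

/-- `t*_0`, computed from the `l`-part of a solution of the linear system. -/
def tZero {n : ℕ} (lam : Outcome n → ℝ) (l : ℕ → ℝ) : ℝ :=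
  (∑ k ∈ Finset.Icc 2 n, levelMass lam k * (k * l k)) /
    (2 * levelMass lam 0 + ∑ k ∈ Finset.Icc 2 n, levelMass lam k * (k * l k))

end CalibratedSignaling

end

/-! The value is found by linear programming duality, with calibration as the constraint. Write `S =
∑ (k - 2) λ_k` for the expected number of clicks beyond the top two.

Lower bound: with at least two clicks, two clicking bidders receive signal 1. With one click, the
clicking bidder and one other receive `t₁`; with no click, two bidders receive `t₀`. This overstates
`t₀`, and `t₁` once it exceeds 1/2; surplus clicking bidders repair it by receiving `t₁` (mass `A`)
or `t₀` (mass `B`), `A + B = S`. Averaging over cyclic shifts of the bidders turns balance in total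
into balance for each bidder (`isCalibrated_twoLevelSignaling`).

Upper bound: calibration gives `E[(o_i - x_i) f(x_i)] = 0` for bounded measurable `f`, so these
terms may be added to the revenue. With `f = price M`, the integrand is bounded pointwise by a
function of the number of clicks (`secmax_add_sum_le`).

The bounds meet for `M = (1 - t₀)² / 2` (`exists_dual_value`). The multipliers at the two levels
agree when `1 - t₀ = √2 (1 - t₁)`; solving for `A` and truncating at 0 gives the maximum in the
linear system. Comparison with the welfare is then the sign of `λ₀ t₀ - λ₁ (1 - t₁)`. -/

namespace CalibratedSignaling

/-! ### Integration against the joint law; calibration as orthogonality of residuals. -/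

section Law

variable {n : ℕ} {lam : Outcome n → ℝ}

theorem isProbabilityMeasure_jointLaw (hlam : IsSymmetricPrior lam) (π : Signaling n) :
    IsProbabilityMeasure (jointLaw lam π) := by
  constructor
  simp only [jointLaw, Measure.coe_finsetSum, Finset.sum_apply, Measure.smul_apply,
    measure_univ, smul_eq_mul, mul_one]
  rw [← ENNReal.ofReal_sum_of_nonneg (fun o _ => hlam.nonneg o), hlam.sum_eq_one,
    ENNReal.ofReal_one]

/-- Integrals against the joint law, as averages over the outcomes. -/
theorem integral_jointLaw (hlam : IsSymmetricPrior lam) (π : Signaling n)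
    {F : Outcome n × BidProfile n → ℝ} (hF : Measurable F) {C : ℝ} (hC : ∀ p, |F p| ≤ C) :
    ∫ p, F p ∂(jointLaw lam π)
      = ∑ o, lam o * ∫ x, F (o, x) ∂(π o : Measure (BidProfile n)) := by
  unfold jointLaw
  rw [integral_finsetSum_measure]
  · refine Finset.sum_congr rfl fun o _ => ?_
    rw [integral_smul_measure, ENNReal.toReal_ofReal (hlam.nonneg o), Measure.dirac_prod,
      integral_map measurable_prodMk_left.aemeasurable hF.aestronglyMeasurable, smul_eq_mul]
  · intro o _
    refine Integrable.smul_measure ?_ ENNReal.ofReal_ne_top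
    exact Integrable.of_bound hF.aestronglyMeasurable C (Filter.Eventually.of_forall hC)

theorem measurable_click (i : Fin n) :
    Measurable fun p : Outcome n × BidProfile n => click p.1 i :=
  (measurable_of_finite (fun o : Outcome n => click o i)).comp measurable_fst

theorem click_nonneg (o : Outcome n) (i : Fin n) : 0 ≤ click o i := by
  unfold click; split_ifs <;> norm_num

theorem click_le_one (o : Outcome n) (i : Fin n) : click o i ≤ 1 := by
  unfold click; split_ifs <;> norm_num

theorem measurable_bid (i : Fin n) :
    Measurable fun p : Outcome n × BidProfile n => p.2 i :=
  (measurable_pi_apply i).comp measurable_snd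

theorem measurable_secmax :
    Measurable fun p : Outcome n × BidProfile n => secmax fun i => (p.2 i : ℝ) := by
  unfold secmax
  exact Measurable.iSup fun q => ((measurable_subtype_coe.comp (measurable_bid _)).min
    (measurable_subtype_coe.comp (measurable_bid _)))

theorem min_le_secmax (x : Fin n → ℝ) {p q : Fin n} (hpq : p ≠ q) :
    min (x p) (x q) ≤ secmax x :=
  le_ciSup (f := fun r : {r : Fin n × Fin n // r.1 ≠ r.2} => min (x r.1.1) (x r.1.2))
    (Set.finite_range _).bddAbove ⟨(p, q), hpq⟩

theorem exists_secmax_eq_min (hn : 2 ≤ n) (x : Fin n → ℝ) :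
    ∃ p q : Fin n, p ≠ q ∧ secmax x = min (x p) (x q) := by
  have : Nonempty {r : Fin n × Fin n // r.1 ≠ r.2} :=
    ⟨⟨(⟨0, by omega⟩, ⟨1, by omega⟩), by simp [Fin.ext_iff]⟩⟩
  obtain ⟨r, hr⟩ := exists_eq_ciSup_of_finite
    (f := fun r : {r : Fin n × Fin n // r.1 ≠ r.2} => min (x r.1.1) (x r.1.2))
  exact ⟨r.1.1, r.1.2, r.2, hr.symm⟩

theorem abs_secmax_le_one (hn : 2 ≤ n) (x : BidProfile n) :
    |secmax fun i => (x i : ℝ)| ≤ 1 := by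
  obtain ⟨p, q, -, h⟩ := exists_secmax_eq_min hn fun i => (x i : ℝ)
  rw [h, abs_le]
  exact ⟨by linarith [le_min (x p).2.1 (x q).2.1], (min_le_left _ _).trans (x p).2.2⟩

theorem revenue_eq_sum (hn : 2 ≤ n) (hlam : IsSymmetricPrior lam) (π : Signaling n) :
    revenue lam π = ∑ o, lam o *
      ∫ x, secmax (fun i => (x i : ℝ)) ∂(π o : Measure (BidProfile n)) :=
  integral_jointLaw hlam π measurable_secmax fun p => abs_secmax_le_one hn p.2

theorem measurable_residual {f : unitInterval → ℝ} (hf : Measurable f) (i : Fin n) :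
    Measurable fun p : Outcome n × BidProfile n => (click p.1 i - p.2 i) * f (p.2 i) :=
  ((measurable_click i).sub (measurable_subtype_coe.comp (measurable_bid i))).mul
    (hf.comp (measurable_bid i))

theorem abs_residual_le {f : unitInterval → ℝ} {C : ℝ} (hC : ∀ x, |f x| ≤ C)
    (i : Fin n) (p : Outcome n × BidProfile n) :
    |(click p.1 i - p.2 i) * f (p.2 i)| ≤ C := by
  have h1 : |click p.1 i - (p.2 i : ℝ)| ≤ 1 := by
    rw [abs_le]
    constructor <;>
      linarith [click_nonneg p.1 i, click_le_one p.1 i, (p.2 i).2.1, (p.2 i).2.2]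
  rw [abs_mul]
  calc _ ≤ 1 * |f (p.2 i)| := mul_le_mul_of_nonneg_right h1 (abs_nonneg _)
    _ ≤ C := by rw [one_mul]; exact hC _

/-- Calibration makes the residual `o_i - x_i` orthogonal to bounded functions of `x_i`. -/
theorem IsCalibrated.integral_residual_eq_zero (hlam : IsSymmetricPrior lam) {π : Signaling n}
    (hπ : IsCalibrated lam π) {f : unitInterval → ℝ} (hf : Measurable f) {C : ℝ}
    (hC : ∀ x, |f x| ≤ C) (i : Fin n) :
    ∫ p, (click p.1 i - p.2 i) * f (p.2 i) ∂(jointLaw lam π) = 0 := by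
  have := isProbabilityMeasure_jointLaw hlam π
  set μ := jointLaw lam π
  have hm : MeasurableSpace.comap (fun p : Outcome n × BidProfile n => p.2 i) inferInstance
      ≤ (inferInstance : MeasurableSpace (Outcome n × BidProfile n)) :=
    (measurable_bid i).comap_le
  have hclick : Integrable (fun p : Outcome n × BidProfile n => click p.1 i) μ :=
    Integrable.of_bound (measurable_click i).aestronglyMeasurable 1
      (Filter.Eventually.of_forall fun p => by
        rw [Real.norm_eq_abs, abs_of_nonneg (click_nonneg _ _)]; exact click_le_one _ _)
  have hbid : Integrable (fun p : Outcome n × BidProfile n => (p.2 i : ℝ)) μ :=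
    Integrable.of_bound
      (measurable_subtype_coe.comp (measurable_bid i)).aestronglyMeasurable 1
      (Filter.Eventually.of_forall fun p => by
        rw [Real.norm_eq_abs, abs_of_nonneg (p.2 i).2.1]; exact (p.2 i).2.2)
  have hfb : ∀ᵐ p : Outcome n × BidProfile n ∂μ, ‖f (p.2 i)‖ ≤ C :=
    Filter.Eventually.of_forall fun p => hC _
  have hfm : AEStronglyMeasurable (fun p : Outcome n × BidProfile n => f (p.2 i)) μ :=
    (hf.comp (measurable_bid i)).aestronglyMeasurable
  have h1 : Integrable (fun p : Outcome n × BidProfile n => f (p.2 i) * click p.1 i) μ :=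
    hclick.bdd_mul hfm hfb
  have h2 : Integrable (fun p : Outcome n × BidProfile n => f (p.2 i) * (p.2 i : ℝ)) μ :=
    hbid.bdd_mul hfm hfb
  have hsm : StronglyMeasurable[MeasurableSpace.comap
      (fun p : Outcome n × BidProfile n => p.2 i) inferInstance]
      fun p : Outcome n × BidProfile n => f (p.2 i) :=
    (hf.comp (comap_measurable _)).stronglyMeasurable
  -- A bounded function of `x_i` may be pulled out of the conditional expectation given `x_i`.
  have key := condExp_stronglyMeasurable_mul_of_bound hm hsm hclick C hfb
  have h3 : ∫ p, f (p.2 i) * click p.1 i ∂μ = ∫ p, f (p.2 i) * (p.2 i : ℝ) ∂μ := by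
    rw [← integral_condExp hm]
    refine integral_congr_ae ?_
    filter_upwards [key, hπ i] with p hp hq
    have hp' := hp
    simp only [Pi.mul_apply] at hp'
    rw [hq] at hp'
    exact hp'
  have h4 : ∀ p : Outcome n × BidProfile n, (click p.1 i - p.2 i) * f (p.2 i)
      = f (p.2 i) * click p.1 i - f (p.2 i) * (p.2 i : ℝ) := fun p => by ring
  simp_rw [h4]
  rw [integral_sub h1 h2, h3, sub_self]

/-- Orthogonality of the residuals to bounded functions of the signal implies calibration. -/
theorem isCalibrated_of_integral_residual_eq_zero (hlam : IsSymmetricPrior lam) {π : Signaling n}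
    (h : ∀ (i : Fin n) (f : unitInterval → ℝ), Measurable f → (∀ x, |f x| ≤ 1) →
      ∫ p, (click p.1 i - p.2 i) * f (p.2 i) ∂(jointLaw lam π) = 0) :
    IsCalibrated lam π := by
  intro i
  have := isProbabilityMeasure_jointLaw hlam π
  set μ := jointLaw lam π
  have hm : MeasurableSpace.comap (fun p : Outcome n × BidProfile n => p.2 i) inferInstance
      ≤ (inferInstance : MeasurableSpace (Outcome n × BidProfile n)) :=
    (measurable_bid i).comap_le
  have hclick : Integrable (fun p : Outcome n × BidProfile n => click p.1 i) μ :=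
    Integrable.of_bound (measurable_click i).aestronglyMeasurable 1
      (Filter.Eventually.of_forall fun p => by
        rw [Real.norm_eq_abs, abs_of_nonneg (click_nonneg _ _)]; exact click_le_one _ _)
  have hbid : Integrable (fun p : Outcome n × BidProfile n => (p.2 i : ℝ)) μ :=
    Integrable.of_bound
      (measurable_subtype_coe.comp (measurable_bid i)).aestronglyMeasurable 1
      (Filter.Eventually.of_forall fun p => by
        rw [Real.norm_eq_abs, abs_of_nonneg (p.2 i).2.1]; exact (p.2 i).2.2)
  refine (ae_eq_condExp_of_forall_setIntegral_eq hm hclick (fun s _ _ => hbid.integrableOn)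
    ?_ ?_).symm
  · rintro s ⟨T, hT, rfl⟩ -
    have hs : MeasurableSet ((fun p : Outcome n × BidProfile n => p.2 i) ⁻¹' T) :=
      measurable_bid i hT
    -- Indicators suffice as test functions: they recover the set integrals that characterize
    -- conditional expectation.
    have h0 := h i (T.indicator fun _ => 1) (measurable_const.indicator hT) (fun x => by
      by_cases hx : x ∈ T <;> simp [hx])
    have h1 : ∀ p : Outcome n × BidProfile n,
        (click p.1 i - p.2 i) * (T.indicator (fun _ => (1 : ℝ)) (p.2 i))
        = ((fun p : Outcome n × BidProfile n => p.2 i) ⁻¹' T).indicator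
            (fun p => click p.1 i - (p.2 i : ℝ)) p := fun p => by
      by_cases hx : p.2 i ∈ T <;> simp [hx]
    simp_rw [h1] at h0
    rw [integral_indicator hs, integral_sub hclick.integrableOn hbid.integrableOn] at h0
    linarith
  · exact ((measurable_subtype_coe.comp (comap_measurable _)).stronglyMeasurable
      (α := Outcome n × BidProfile n)).aestronglyMeasurable

theorem clicks_le (o : Outcome n) : clicks o ≤ n := by
  simpa [clicks] using Finset.card_filter_le (Finset.univ : Finset (Fin n)) fun i => o i = true

theorem sum_mul_clicks (lam : Outcome n → ℝ) (v : ℕ → ℝ) :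
    ∑ o, lam o * v (clicks o) = ∑ k ∈ Finset.range (n + 1), levelMass lam k * v k := by
  rw [← Finset.sum_fiberwise_of_maps_to (s := Finset.univ) (t := Finset.range (n + 1))
    (g := fun o : Outcome n => clicks o)
    (fun o _ => Finset.mem_range.2 (Nat.lt_succ_of_le (clicks_le o)))]
  refine Finset.sum_congr rfl fun k _ => ?_
  rw [levelMass, Finset.sum_mul]
  refine Finset.sum_congr rfl fun o ho => ?_
  rw [(Finset.mem_filter.1 ho).2]

theorem sum_range_succ_eq_sum_Icc_two (hn : 1 ≤ n) (g : ℕ → ℝ) :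
    ∑ k ∈ Finset.range (n + 1), g k = g 0 + g 1 + ∑ k ∈ Finset.Icc 2 n, g k := by
  have h : Finset.range (n + 1) = insert 0 (insert 1 (Finset.Icc 2 n)) := by
    ext k; simp only [Finset.mem_range, Finset.mem_insert, Finset.mem_Icc]; omega
  rw [h, Finset.sum_insert (by simp), Finset.sum_insert (by simp), add_assoc]

theorem levelMass_nonneg (hlam : IsSymmetricPrior lam) (k : ℕ) : 0 ≤ levelMass lam k :=
  Finset.sum_nonneg fun o _ => hlam.nonneg o

end Law

/-! ### Dual prices and the upper bound on revenue. -/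

section Dual

/-- The multiplier of the calibration constraint at the signal `x`. -/
noncomputable def price (M x : ℝ) : ℝ := M / max (1 - x) (2 * M)

variable {M : ℝ}

theorem price_nonneg (hM : 0 < M) (x : ℝ) : 0 ≤ price M x :=
  div_nonneg hM.le ((by positivity : (0 : ℝ) ≤ 2 * M).trans (le_max_right _ _))

theorem price_of_le {x : ℝ} (h : 2 * M ≤ 1 - x) : price M x = M / (1 - x) := by
  rw [price, max_eq_left h]

theorem price_of_ge (hM : 0 < M) {x : ℝ} (h : 1 - x ≤ 2 * M) : price M x = 1 / 2 := by
  rw [price, max_eq_right h]; field_simp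

theorem price_le_half (hM : 0 < M) (x : ℝ) : price M x ≤ 1 / 2 := by
  rw [price, div_le_iff₀ (by positivity)]
  linarith [le_max_right (1 - x) (2 * M)]

theorem price_mono (hM : 0 < M) {x y : ℝ} (h : x ≤ y) : price M x ≤ price M y := by
  unfold price
  gcongr

/-- This identity dictates the form of the price: a clicking bidder outside the top pair contributes
at most `M`, and the cap 1/2 keeps two clicking top bidders at signal `y` from lifting the total
above `y + (1 - y) = 1`. -/
theorem one_sub_mul_price (hM : 0 < M) (x : ℝ) :
    (1 - x) * price M x = min M ((1 - x) / 2) := by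
  rcases le_total (2 * M) (1 - x) with h | h
  · rw [price_of_le h, min_eq_left (by linarith), mul_div_cancel₀]
    linarith
  · rw [price_of_ge hM h, min_eq_right (by linarith)]; ring

theorem continuous_price (hM : 0 < M) : Continuous (price M) := by
  unfold price
  refine continuous_const.div (by fun_prop) fun x => ?_
  have := le_max_right (1 - x) (2 * M)
  linarith

variable {n : ℕ}

/-- Summing all but two terms, each bounded by `M` at a click and by `0` otherwise. -/
theorem sum_le_pair_add {u : Fin n → ℝ} (o : Outcome n)
    (hu : ∀ i, u i ≤ M * click o i) {p q : Fin n} (hpq : p ≠ q) :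
    ∑ i, u i ≤ u p + u q + M * (clicks o - click o p - click o q) := by
  have hc : (clicks o : ℝ) = ∑ i, click o i := by
    simp [clicks, click]
  have hsplit : ∀ w : Fin n → ℝ,
      ∑ i, w i = w p + (w q + ∑ i ∈ (Finset.univ.erase p).erase q, w i) := fun w => by
    rw [Finset.add_sum_erase _ _ (by simp [hpq.symm]), Finset.add_sum_erase _ _ (by simp)]
  have h1 := hsplit u
  have h2 := hsplit (click o)
  have h3 := Finset.sum_le_sum fun i (_ : i ∈ (Finset.univ.erase p).erase q) => hu i
  rw [← Finset.mul_sum] at h3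
  have h4 : ∑ i ∈ (Finset.univ.erase p).erase q, click o i
      = clicks o - click o p - click o q := by linarith
  rw [h4] at h3
  linarith

/-- The value of the dual program at an outcome with `k` clicks. -/
def dualValue (M v₀ v₁ : ℝ) : ℕ → ℝ
  | 0 => v₀
  | 1 => v₁
  | k + 2 => 1 + k * M

/-- Only a pair attaining the second maximum `y` matters: any other bidder adds at most `M` if
clicking and at most 0 otherwise, and both members of the pair may be lowered to `y`. The number of
clicks inside the pair then selects `H0`, `H1` or the bound 1. -/
theorem secmax_add_sum_le (hn : 2 ≤ n) (hM : 0 < M) {v₀ v₁ : ℝ}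
    (H0 : ∀ y, 0 ≤ y → y ≤ 1 → y - 2 * (y * price M y) ≤ v₀)
    (H1 : ∀ y, 0 ≤ y → y ≤ 1 → y + (1 - 2 * y) * price M y ≤ v₁)
    (H01 : v₀ + M ≤ v₁) (H12 : v₁ + M ≤ 1) (o : Outcome n) (x : BidProfile n) :
    secmax (fun i => (x i : ℝ)) + ∑ i, (click o i - x i) * price M (x i)
      ≤ dualValue M v₀ v₁ (clicks o) := by
  obtain ⟨p, q, hpq, hs⟩ := exists_secmax_eq_min hn fun i => (x i : ℝ)
  rw [hs]
  have hu : ∀ i, (click o i - x i) * price M (x i) ≤ M * click o i := fun i => by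
    have h1 := one_sub_mul_price hM (x i)
    have h2 := min_le_left M ((1 - (x i : ℝ)) / 2)
    have h3 := mul_nonneg (x i).2.1 (price_nonneg hM (x i))
    unfold click
    split_ifs <;> linarith
  have hsum := sum_le_pair_add o hu hpq
  obtain ⟨y, hy⟩ : ∃ y, y = min (x p : ℝ) (x q) := ⟨_, rfl⟩
  rw [← hy]
  have hyp : y ≤ x p := hy ▸ min_le_left _ _
  have hyq : y ≤ x q := hy ▸ min_le_right _ _
  have hy0 : 0 ≤ y := hy ▸ le_min (x p).2.1 (x q).2.1
  have hy1 : y ≤ 1 := hyp.trans (x p).2.2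
  -- Each term is nonincreasing in the signal: with a click it is `min M ((1 - x) / 2)`, without one
  -- it is `-x` times a nondecreasing price.
  have hmono : ∀ i, y ≤ x i →
      (click o i - x i) * price M (x i) ≤ (click o i - y) * price M y := fun i hi => by
    unfold click
    split_ifs
    · rw [one_sub_mul_price hM, one_sub_mul_price hM]
      exact min_le_min_left _ (by linarith)
    · have := mul_le_mul hi (price_mono hM hi) (price_nonneg hM y) (hy0.trans hi)
      linarith
  have hp := hmono p hyp
  have hq := hmono q hyq
  have hboth : (1 - y) * price M y ≤ (1 - y) / 2 := by
    rw [one_sub_mul_price hM]; exact min_le_right _ _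
  have h0 := H0 y hy0 hy1
  have h1 := H1 y hy0 hy1
  have hcard : ∀ i, o i = true → i ∈ Finset.univ.filter fun i => o i = true := by simp
  rcases hk : clicks o with _ | _ | k
  · have hz : ∀ i, click o i = 0 := fun i => if_neg fun hi =>
      absurd (Finset.card_pos.2 ⟨i, hcard i hi⟩) (by rw [← clicks, hk]; simp)
    rw [hz] at hp hq
    rw [hk, hz, hz] at hsum
    push_cast at hsum
    simp only [dualValue]
    linarith
  · simp only [dualValue]
    have hnot : ¬ (o p = true ∧ o q = true) := fun ⟨h, h'⟩ => by
      have := Finset.one_lt_card.2 ⟨p, hcard p h, q, hcard q h', hpq⟩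
      rw [← clicks, hk] at this
      omega
    rw [hk] at hsum
    push_cast at hsum
    by_cases ho : o p = true <;> by_cases ho' : o q = true
    · exact absurd ⟨ho, ho'⟩ hnot
    all_goals
      simp only [click, ho, ho', if_true] at hsum hp hq ⊢
      norm_num at hsum hp hq ⊢
      linarith
  -- Each click moved from the pair to the rest gains at most `M`, which `H01` and `H12` show is no
  -- improvement; two clicks in the pair are the worst case.
  · simp only [dualValue]
    rw [hk] at hsum
    push_cast at hsum
    by_cases ho : o p = true <;> by_cases ho' : o q = true
    all_goals
      simp only [click, ho, ho', if_true] at hsum hp hq ⊢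
      norm_num at hsum hp hq ⊢
      linarith

/-- Weak duality: every calibrated signaling earns at most the dual value. -/
theorem IsCalibrated.revenue_le (hn : 2 ≤ n) {lam : Outcome n → ℝ} (hlam : IsSymmetricPrior lam)
    (hM : 0 < M) {v₀ v₁ : ℝ}
    (H0 : ∀ y, 0 ≤ y → y ≤ 1 → y - 2 * (y * price M y) ≤ v₀)
    (H1 : ∀ y, 0 ≤ y → y ≤ 1 → y + (1 - 2 * y) * price M y ≤ v₁)
    (H01 : v₀ + M ≤ v₁) (H12 : v₁ + M ≤ 1) {π : Signaling n} (hπ : IsCalibrated lam π) :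
    revenue lam π ≤ ∑ o, lam o * dualValue M v₀ v₁ (clicks o) := by
  have := isProbabilityMeasure_jointLaw hlam π
  set f : unitInterval → ℝ := fun x => price M x
  have hf : Measurable f := ((continuous_price hM).comp continuous_subtype_val).measurable
  have hC : ∀ x, |f x| ≤ 1 := fun x => by
    rw [abs_of_nonneg (price_nonneg hM _)]
    linarith [price_le_half hM (x : ℝ)]
  have hres : ∀ i, Integrable (fun p : Outcome n × BidProfile n =>
      (click p.1 i - p.2 i) * f (p.2 i)) (jointLaw lam π) := fun i =>
    Integrable.of_bound (measurable_residual hf i).aestronglyMeasurable 1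
      (Filter.Eventually.of_forall (abs_residual_le hC i))
  have hsec : Integrable (fun p : Outcome n × BidProfile n => secmax fun i => (p.2 i : ℝ))
      (jointLaw lam π) :=
    Integrable.of_bound measurable_secmax.aestronglyMeasurable 1
      (Filter.Eventually.of_forall fun p => abs_secmax_le_one hn p.2)
  have hval : Measurable fun p : Outcome n × BidProfile n => dualValue M v₀ v₁ (clicks p.1) :=
    (measurable_of_finite fun o : Outcome n => dualValue M v₀ v₁ (clicks o)).comp measurable_fst
  have hvalC : ∀ p : Outcome n × BidProfile n, |dualValue M v₀ v₁ (clicks p.1)|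
      ≤ ∑ o : Outcome n, |dualValue M v₀ v₁ (clicks o)| := fun p =>
    Finset.single_le_sum (f := fun o : Outcome n => |dualValue M v₀ v₁ (clicks o)|)
      (fun o _ => abs_nonneg _) (Finset.mem_univ p.1)
  -- The added residual terms integrate to 0 by calibration.
  calc revenue lam π
      = ∫ p, (secmax (fun i => (p.2 i : ℝ)) + ∑ i, (click p.1 i - p.2 i) * f (p.2 i))
          ∂(jointLaw lam π) := by
        rw [integral_add hsec (integrable_finsetSum _ fun i _ => hres i),
          integral_finsetSum _ fun i _ => hres i,
          Finset.sum_eq_zero fun i _ => hπ.integral_residual_eq_zero hlam hf hC i, add_zero]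
        rfl
    _ ≤ ∫ p, dualValue M v₀ v₁ (clicks p.1) ∂(jointLaw lam π) :=
        integral_mono (hsec.add (integrable_finsetSum _ fun i _ => hres i))
          (Integrable.of_bound hval.aestronglyMeasurable _ (Filter.Eventually.of_forall hvalC))
          fun p => secmax_add_sum_le hn hM H0 H1 H01 H12 p.1 p.2
    _ = ∑ o, lam o * dualValue M v₀ v₁ (clicks o) := by
        rw [integral_jointLaw hlam π hval hvalC]
        simp

/-- Below the cap the gap is the square `(1 - y - b)² / (1 - y)`, so the candidate for equality is
`y = 1 - b`; where the cap binds the left side is 0. -/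
theorem sub_price_le {b : ℝ} (hb : 0 < b) (hM : M = b ^ 2 / 2) (y : ℝ) :
    y - 2 * (y * price M y) ≤ (1 - b) ^ 2 := by
  have hM0 : 0 < M := by rw [hM]; positivity
  rcases le_total (2 * M) (1 - y) with h | h
  · rw [price_of_le h]
    have hu : 0 < 1 - y := by linarith
    have : (1 - b) ^ 2 - (y - 2 * (y * (M / (1 - y)))) = (1 - y - b) ^ 2 / (1 - y) := by
      rw [hM]; field_simp; ring
    have := div_nonneg (sq_nonneg (1 - y - b)) hu.le
    linarith
  · rw [price_of_ge hM0 h]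
    nlinarith [sq_nonneg (1 - b)]

/-- Again a perfect square below the cap, vanishing at `y = 1 - a`. Where the cap binds the left
side is 1/2, and the gap is `(1 - 2a)² / 2`. -/
theorem add_price_le_of_sq {a : ℝ} (ha : 0 < a) (hM : M = a ^ 2) (y : ℝ) :
    y + (1 - 2 * y) * price M y ≤ (1 - a) ^ 2 + a ^ 2 := by
  have hM0 : 0 < M := by rw [hM]; positivity
  rcases le_total (2 * M) (1 - y) with h | h
  · rw [price_of_le h]
    have hu : 0 < 1 - y := by linarith
    have : (1 - a) ^ 2 + a ^ 2 - (y + (1 - 2 * y) * (M / (1 - y)))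
        = (1 - y - a) ^ 2 / (1 - y) := by
      rw [hM]; field_simp; ring
    have := div_nonneg (sq_nonneg (1 - y - a)) hu.le
    linarith
  · rw [price_of_ge hM0 h]
    nlinarith [sq_nonneg (1 - 2 * a)]

/-- For such `M` the cap binds as soon as `y ≥ 1/2`; below that, `1 - 2y ≥ 0` and the price is at
most 1/2. -/
theorem add_price_le_half (hM : 1 / 4 ≤ M) (y : ℝ) :
    y + (1 - 2 * y) * price M y ≤ 1 / 2 := by
  have hM0 : 0 < M := by linarith
  rcases le_total (2 * M) (1 - y) with h | h
  · have h2 := price_le_half hM0 y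
    nlinarith
  · rw [price_of_ge hM0 h]
    linarith

end Dual

end CalibratedSignaling

namespace CalibratedSignaling

/-! ### Finitely supported signal distributions. -/

section Mixture

variable {ι α : Type*} [Fintype ι] [MeasurableSpace α]

/-- The finite mixture of the points `x z` with weights `w z`. -/
noncomputable def mixture (w : ι → ℝ) (hw : ∀ z, 0 ≤ w z) (hw1 : ∑ z, w z = 1) (x : ι → α) :
    ProbabilityMeasure α :=
  ⟨∑ z, ENNReal.ofReal (w z) • Measure.dirac (x z), ⟨by
    simp only [Measure.coe_finsetSum, Finset.sum_apply, Measure.smul_apply, measure_univ,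
      smul_eq_mul, mul_one]
    rw [← ENNReal.ofReal_sum_of_nonneg fun z _ => hw z, hw1, ENNReal.ofReal_one]⟩⟩

theorem integral_mixture [MeasurableSingletonClass α] (w : ι → ℝ) (hw : ∀ z, 0 ≤ w z)
    (hw1 : ∑ z, w z = 1) (x : ι → α) (F : α → ℝ) :
    ∫ y, F y ∂(mixture w hw hw1 x : Measure α) = ∑ z, w z * F (x z) := by
  change ∫ y, F y ∂(∑ z, ENNReal.ofReal (w z) • Measure.dirac (x z)) = _
  rw [integral_finsetSum_measure]
  · refine Finset.sum_congr rfl fun z _ => ?_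
    rw [integral_smul_measure, integral_dirac, ENNReal.toReal_ofReal (hw z), smul_eq_mul]
  · intro z _
    exact (integrable_dirac (by simp)).smul_measure ENNReal.ofReal_ne_top

end Mixture

/-! ### The unsymmetrized signaling and its total residual. -/

section Base

variable {n : ℕ}

theorem exists_pair (hn : 2 ≤ n) (o : Outcome n) :
    ∃ P : Finset (Fin n), P.card = 2 ∧
      (P ∩ Finset.univ.filter fun i => o i = true).card = min (clicks o) 2 := by
  rcases le_total (clicks o) 2 with h | h
  · obtain ⟨P, hP, -, hc⟩ := Finset.exists_subsuperset_card_eq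
      (Finset.subset_univ (Finset.univ.filter fun i => o i = true)) h (by simpa using hn)
    exact ⟨P, hc, by rw [Finset.inter_eq_right.2 hP, min_eq_left h]; rfl⟩
  · obtain ⟨P, -, hP, hc⟩ := Finset.exists_subsuperset_card_eq
      (Finset.empty_subset (Finset.univ.filter fun i => o i = true)) (by simp) h
    exact ⟨P, hc, by rw [Finset.inter_eq_left.2 hP, min_eq_right h, hc]⟩

/-- The two bidders that receive the highest signal: clicking ones, as far as possible. -/
noncomputable def topPair (hn : 2 ≤ n) (o : Outcome n) : Finset (Fin n) :=
  (exists_pair hn o).choose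

theorem card_topPair (hn : 2 ≤ n) (o : Outcome n) : (topPair hn o).card = 2 :=
  (exists_pair hn o).choose_spec.1

theorem card_topPair_inter (hn : 2 ≤ n) (o : Outcome n) :
    (topPair hn o ∩ Finset.univ.filter fun i => o i = true).card = min (clicks o) 2 :=
  (exists_pair hn o).choose_spec.2

/-- The signal of the top pair when there are `k` clicks. -/
def topSignal (t₀ t₁ : unitInterval) : ℕ → unitInterval
  | 0 => t₀
  | 1 => t₁
  | _ + 2 => 1

/-- The unsymmetrized signal profile: the remaining clicking bidders receive `s`, the others `0`. -/
noncomputable def baseSignal (hn : 2 ≤ n) (t₀ t₁ s : unitInterval) (o : Outcome n) :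
    BidProfile n := fun i =>
  if i ∈ topPair hn o then topSignal t₀ t₁ (clicks o) else if o i = true then s else 0

/-- The total residual of the base signal profile against a test function. -/
def totalResidual (t₀ t₁ s : unitInterval) (f : unitInterval → ℝ) : ℕ → ℝ
  | 0 => -(2 * t₀ * f t₀)
  | 1 => (1 - 2 * t₁) * f t₁
  | k + 2 => k * ((1 - s) * f s)

/-- Clicking bidders at signal 1 and non-clicking ones at 0 have no residual. What remains is the
top pair when there are fewer than two clicks, or else the `k - 2` surplus clicking bidders at `s`.
-/
theorem sum_residual_baseSignal (hn : 2 ≤ n) (t₀ t₁ s : unitInterval) (f : unitInterval → ℝ)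
    (o : Outcome n) :
    ∑ i, (click o i - baseSignal hn t₀ t₁ s o i) * f (baseSignal hn t₀ t₁ s o i)
      = totalResidual t₀ t₁ s f (clicks o) := by
  have hin : ∑ i ∈ topPair hn o, click o i = min (clicks o : ℝ) 2 := by
    have hcast : min (clicks o : ℝ) 2 = ((min (clicks o) 2 : ℕ) : ℝ) := by push_cast; rfl
    rw [hcast, ← card_topPair_inter hn o,
      ← Finset.filter_mem_eq_inter]
    simp [click]
  have hall : ∑ i, click o i = clicks o := by simp [clicks, click]
  have hout : ∑ i ∈ (topPair hn o)ᶜ, click o i = clicks o - min (clicks o : ℝ) 2 := by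
    rw [← hin, ← hall, ← Finset.sum_add_sum_compl (topPair hn o)]
    ring
  rw [← Finset.sum_add_sum_compl (topPair hn o)]
  have h1 : ∑ i ∈ topPair hn o,
      (click o i - baseSignal hn t₀ t₁ s o i) * f (baseSignal hn t₀ t₁ s o i)
      = (min (clicks o : ℝ) 2 - 2 * topSignal t₀ t₁ (clicks o))
          * f (topSignal t₀ t₁ (clicks o)) := by
    rw [← hin, Finset.sum_congr rfl fun i hi => by rw [baseSignal, if_pos hi],
      ← Finset.sum_mul, Finset.sum_sub_distrib, Finset.sum_const, card_topPair]
    simp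
  have h2 : ∑ i ∈ (topPair hn o)ᶜ,
      (click o i - baseSignal hn t₀ t₁ s o i) * f (baseSignal hn t₀ t₁ s o i)
      = (clicks o - min (clicks o : ℝ) 2) * ((1 - s) * f s) := by
    rw [← hout, Finset.sum_mul]
    refine Finset.sum_congr rfl fun i hi => ?_
    rw [baseSignal, if_neg (Finset.mem_compl.1 hi), click]
    split_ifs <;> simp
  rw [h1, h2]
  rcases clicks o with _ | _ | k
  · simp [topSignal, totalResidual]
  · simp [topSignal, totalResidual]
  · have hk : min ((k : ℝ) + 1 + 1) 2 = 2 := min_eq_right (by linarith [k.cast_nonneg (α := ℝ)])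
    simp only [topSignal, totalResidual]
    push_cast
    rw [hk]
    ring

theorem sum_mul_totalResidual (hn : 1 ≤ n) (lam : Outcome n → ℝ) (t₀ t₁ s : unitInterval)
    (f : unitInterval → ℝ) :
    ∑ o, lam o * totalResidual t₀ t₁ s f (clicks o)
      = -(levelMass lam 0 * (2 * t₀ * f t₀)) + levelMass lam 1 * ((1 - 2 * t₁) * f t₁)
        + (∑ k ∈ Finset.Icc 2 n, ((k : ℝ) - 2) * levelMass lam k) * ((1 - s) * f s) := by
  rw [sum_mul_clicks lam (totalResidual t₀ t₁ s f), sum_range_succ_eq_sum_Icc_two hn,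
    Finset.sum_mul]
  congr 1
  · simp [totalResidual]
  · refine Finset.sum_congr rfl fun k hk => ?_
    obtain ⟨j, rfl⟩ := Nat.exists_eq_add_of_le' (Finset.mem_Icc.1 hk).1
    simp only [totalResidual]
    push_cast
    ring

/-- The probability of the shift `a` together with the high or low signal for the surplus. -/
noncomputable def mixWeight (n : ℕ) (c : ℝ) (z : Fin n × Bool) : ℝ :=
  (n : ℝ)⁻¹ * (if z.2 = true then c else 1 - c)

theorem mixWeight_nonneg {c : ℝ} (hc0 : 0 ≤ c) (hc1 : c ≤ 1) (z : Fin n × Bool) :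
    0 ≤ mixWeight n c z := by
  unfold mixWeight
  refine mul_nonneg (by positivity) ?_
  split_ifs <;> linarith

theorem sum_mixWeight_mul (c : ℝ) (F : Fin n → Bool → ℝ) :
    ∑ z : Fin n × Bool, mixWeight n c z * F z.1 z.2
      = (n : ℝ)⁻¹ * (c * ∑ a, F a true + (1 - c) * ∑ a, F a false) := by
  rw [Fintype.sum_prod_type]
  simp only [mixWeight, Fintype.sum_bool, if_true, Finset.sum_add_distrib, ← Finset.mul_sum]
  simp only [Bool.false_eq_true, if_false, mul_assoc, ← Finset.mul_sum]
  ring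

end Base

/-! ### Symmetrization over cyclic shifts. -/

section Shifted

variable {n : ℕ} [NeZero n]

/-- The profile seen after relabeling the bidders by a cyclic shift. -/
def shift (a : Fin n) (o : Outcome n) : Outcome n := fun j => o (j + a)

theorem clicks_shift (a : Fin n) (o : Outcome n) : clicks (shift a o) = clicks o := by
  unfold clicks
  refine Finset.card_bij (fun j _ => j + a) ?_ ?_ ?_
  · intro j hj
    exact Finset.mem_filter.2 ⟨Finset.mem_univ _, (Finset.mem_filter.1 hj).2⟩
  · intro i _ j _ h
    simpa using h
  · intro j hj
    exact ⟨j - a, Finset.mem_filter.2 ⟨Finset.mem_univ _, by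
      simpa [shift] using (Finset.mem_filter.1 hj).2⟩, by simp⟩

theorem sum_shift {lam : Outcome n → ℝ} (hlam : IsSymmetricPrior lam) (a : Fin n)
    (φ : Outcome n → ℝ) : ∑ o, lam o * φ (shift a o) = ∑ o, lam o * φ o := by
  refine Fintype.sum_equiv (Equiv.arrowCongr (Equiv.addRight (-a)) (Equiv.refl Bool)) _ _ ?_
  intro o
  have h : (Equiv.arrowCongr (Equiv.addRight (-a)) (Equiv.refl Bool)) o = shift a o := by
    ext j
    simp [Equiv.arrowCongr, shift]
  rw [h]
  congr 1
  exact (hlam.symm (Equiv.addRight a) o).symm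

theorem sum_mixWeight (c : ℝ) : ∑ z, mixWeight n c z = 1 := by
  have hn : (n : ℝ) ≠ 0 := Nat.cast_ne_zero.2 (NeZero.ne n)
  have h := sum_mixWeight_mul (n := n) c fun _ _ => 1
  simp only [mul_one, Finset.sum_const, Finset.card_univ, Fintype.card_fin, nsmul_eq_mul] at h
  rw [h]
  field_simp
  ring

/-- The base signal profile of the shifted outcome, shifted back. -/
noncomputable def shiftedSignal (hn : 2 ≤ n) (t₀ t₁ : unitInterval) (o : Outcome n)
    (z : Fin n × Bool) : BidProfile n := fun i =>
  baseSignal hn t₀ t₁ (if z.2 = true then t₁ else t₀) (shift z.1 o) (i - z.1)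

/-- The symmetrized two-level signaling. -/
noncomputable def twoLevelSignaling (hn : 2 ≤ n) (t₀ t₁ : unitInterval) {c : ℝ} (hc0 : 0 ≤ c)
    (hc1 : c ≤ 1) : Signaling n := fun o =>
  mixture (mixWeight n c) (mixWeight_nonneg hc0 hc1) (sum_mixWeight c)
    (shiftedSignal hn t₀ t₁ o)

theorem topSignal_le_secmax (hn : 2 ≤ n) (t₀ t₁ : unitInterval) (o : Outcome n)
    (z : Fin n × Bool) :
    (topSignal t₀ t₁ (clicks o) : ℝ) ≤ secmax fun i => (shiftedSignal hn t₀ t₁ o z i : ℝ) := by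
  obtain ⟨p, q, hpq, hP⟩ := Finset.card_eq_two.1 (card_topPair hn (shift z.1 o))
  have hval : ∀ j ∈ topPair hn (shift z.1 o),
      shiftedSignal hn t₀ t₁ o z (j + z.1) = topSignal t₀ t₁ (clicks o) := fun j hj => by
    rw [shiftedSignal, add_sub_cancel_right, baseSignal, if_pos hj, clicks_shift]
  have h := min_le_secmax (fun i => (shiftedSignal hn t₀ t₁ o z i : ℝ))
    (p := p + z.1) (q := q + z.1) (by simpa using hpq)
  simp only [hval p (by simp [hP]), hval q (by simp [hP]), min_self] at h
  exact h

theorem le_revenue_twoLevelSignaling (hn : 2 ≤ n) {lam : Outcome n → ℝ}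
    (hlam : IsSymmetricPrior lam) (t₀ t₁ : unitInterval) {c : ℝ} (hc0 : 0 ≤ c) (hc1 : c ≤ 1) :
    ∑ o, lam o * topSignal t₀ t₁ (clicks o)
      ≤ revenue lam (twoLevelSignaling hn t₀ t₁ hc0 hc1) := by
  rw [revenue_eq_sum hn hlam]
  refine Finset.sum_le_sum fun o _ => mul_le_mul_of_nonneg_left ?_ (hlam.nonneg o)
  rw [twoLevelSignaling, integral_mixture]
  calc (topSignal t₀ t₁ (clicks o) : ℝ)
      = ∑ z : Fin n × Bool, mixWeight n c z * topSignal t₀ t₁ (clicks o) := by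
        rw [← Finset.sum_mul, sum_mixWeight, one_mul]
    _ ≤ _ := Finset.sum_le_sum fun z _ => mul_le_mul_of_nonneg_left
        (topSignal_le_secmax hn t₀ t₁ o z) (mixWeight_nonneg hc0 hc1 z)

/-- `H1` and `H0` balance the total residual at `t₁` and at `t₀`. Under a uniform shift and a
symmetric prior, each bidder's expected residual is `1/n` of the total, so cyclic shifts suffice. -/
theorem isCalibrated_twoLevelSignaling (hn : 2 ≤ n) {lam : Outcome n → ℝ}
    (hlam : IsSymmetricPrior lam) (t₀ t₁ : unitInterval) {c : ℝ} (hc0 : 0 ≤ c) (hc1 : c ≤ 1)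
    (H1 : levelMass lam 1 * (1 - 2 * t₁)
      + c * (∑ k ∈ Finset.Icc 2 n, ((k : ℝ) - 2) * levelMass lam k) * (1 - t₁) = 0)
    (H0 : (1 - c) * (∑ k ∈ Finset.Icc 2 n, ((k : ℝ) - 2) * levelMass lam k) * (1 - t₀)
      = levelMass lam 0 * (2 * t₀)) :
    IsCalibrated lam (twoLevelSignaling hn t₀ t₁ hc0 hc1) := by
  refine isCalibrated_of_integral_residual_eq_zero hlam fun i f hf hC => ?_
  rw [integral_jointLaw hlam _ (measurable_residual hf i) (abs_residual_le hC i)]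
  set φ : unitInterval → Outcome n → Fin n → ℝ := fun s o j =>
    (click o j - baseSignal hn t₀ t₁ s o j) * f (baseSignal hn t₀ t₁ s o j)
  have hφ : ∀ (o : Outcome n) (z : Fin n × Bool),
      (click o i - shiftedSignal hn t₀ t₁ o z i) * f (shiftedSignal hn t₀ t₁ o z i)
      = φ (if z.2 = true then t₁ else t₀) (shift z.1 o) (i - z.1) := fun o z => by
    simp only [φ, shiftedSignal, click, shift, sub_add_cancel]
  have hsum : ∀ s : unitInterval,
      ∑ a, ∑ o, lam o * φ s (shift a o) (i - a)
        = ∑ o, lam o * totalResidual t₀ t₁ s f (clicks o) := fun s => by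
    rw [Finset.sum_congr rfl fun a _ => sum_shift hlam a fun o => φ s o (i - a),
      Finset.sum_comm]
    refine Finset.sum_congr rfl fun o _ => ?_
    rw [← Finset.mul_sum, show ∑ a, φ s o (i - a) = ∑ j, φ s o j from
      Equiv.sum_comp (Equiv.subLeft i) (φ s o), sum_residual_baseSignal hn t₀ t₁ s f o]
  calc ∑ o, lam o * ∫ x, (click o i - x i) * f (x i)
        ∂(twoLevelSignaling hn t₀ t₁ hc0 hc1 o : Measure (BidProfile n))
      = ∑ z : Fin n × Bool, mixWeight n c z *
          ∑ o, lam o * φ (if z.2 = true then t₁ else t₀) (shift z.1 o) (i - z.1) := by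
        simp only [twoLevelSignaling, integral_mixture, hφ, Finset.mul_sum]
        rw [Finset.sum_comm]
        refine Finset.sum_congr rfl fun z _ => Finset.sum_congr rfl fun o _ => ?_
        ring
    _ = 0 := by
        rw [sum_mixWeight_mul c fun a b =>
          ∑ o, lam o * φ (if b = true then t₁ else t₀) (shift a o) (i - a)]
        simp only [if_true, Bool.false_eq_true, if_false]
        rw [hsum, hsum, sum_mul_totalResidual (by omega), sum_mul_totalResidual (by omega)]
        -- The terms for zero and one click occur with weights `c` and `1 - c`, hence once in all;
        -- the surplus splits as `c S` at `t₁` and `(1 - c) S` at `t₀`.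
        linear_combination (n : ℝ)⁻¹ * f t₁ * H1 + (n : ℝ)⁻¹ * f t₀ * H0

end Shifted

end CalibratedSignaling

namespace CalibratedSignaling

/-! ### Matching the two bounds, and comparison with welfare. -/

section Main

variable {n : ℕ} {lam : Outcome n → ℝ}

theorem sum_mul_topSignal (hn : 1 ≤ n) (lam : Outcome n → ℝ) (t₀ t₁ : unitInterval) :
    ∑ o, lam o * topSignal t₀ t₁ (clicks o)
      = levelMass lam 0 * t₀ + levelMass lam 1 * t₁ + ∑ k ∈ Finset.Icc 2 n, levelMass lam k := by
  rw [sum_mul_clicks lam fun k => (topSignal t₀ t₁ k : ℝ), sum_range_succ_eq_sum_Icc_two hn]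
  congr 1
  refine Finset.sum_congr rfl fun k hk => ?_
  obtain ⟨j, rfl⟩ := Nat.exists_eq_add_of_le' (Finset.mem_Icc.1 hk).1
  simp [topSignal]

theorem sum_mul_dualValue (hn : 1 ≤ n) (lam : Outcome n → ℝ) (M v₀ v₁ : ℝ) :
    ∑ o, lam o * dualValue M v₀ v₁ (clicks o)
      = levelMass lam 0 * v₀ + levelMass lam 1 * v₁ + ∑ k ∈ Finset.Icc 2 n, levelMass lam k
        + (∑ k ∈ Finset.Icc 2 n, ((k : ℝ) - 2) * levelMass lam k) * M := by
  rw [sum_mul_clicks lam (dualValue M v₀ v₁), sum_range_succ_eq_sum_Icc_two hn, Finset.sum_mul,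
    add_assoc (_ + _), ← Finset.sum_add_distrib]
  congr 1
  refine Finset.sum_congr rfl fun k hk => ?_
  obtain ⟨j, rfl⟩ := Nat.exists_eq_add_of_le' (Finset.mem_Icc.1 hk).1
  simp only [dualValue]
  push_cast
  ring

/-- The surplus click mass used for the high signal. -/
noncomputable def highMass (lam₀ lam₁ S : ℝ) : ℝ :=
  max ((lam₁ * S + 2 * lam₁ * lam₀ * (1 - Real.sqrt 2)) / (lam₁ + Real.sqrt 2 * lam₀)) 0

theorem highMass_nonneg (lam₀ lam₁ S : ℝ) : 0 ≤ highMass lam₀ lam₁ S := le_max_right _ _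

theorem highMass_le {lam₀ lam₁ S : ℝ} (h0 : 0 < lam₀) (h1 : 0 ≤ lam₁) (hS : 0 ≤ S) :
    highMass lam₀ lam₁ S ≤ S := by
  have hs : 1 ≤ Real.sqrt 2 := Real.one_le_sqrt.2 (by norm_num)
  refine max_le ?_ hS
  rw [div_le_iff₀ (by positivity)]
  have := mul_nonneg (mul_nonneg h1 h0.le) (sub_nonneg.2 hs)
  have := mul_nonneg hS (mul_nonneg (by positivity : 0 ≤ Real.sqrt 2) h0.le)
  linarith

theorem highMass_lt {lam₀ lam₁ S : ℝ} (h0 : 0 < lam₀) (h1 : 0 ≤ lam₁) (hS : 0 < S) :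
    highMass lam₀ lam₁ S < S := by
  have hs : 1 ≤ Real.sqrt 2 := Real.one_le_sqrt.2 (by norm_num)
  refine max_lt ?_ hS
  rw [div_lt_iff₀ (by positivity)]
  have := mul_nonneg (mul_nonneg h1 h0.le) (sub_nonneg.2 hs)
  have := mul_pos hS (mul_pos (by positivity : 0 < Real.sqrt 2) h0)
  linarith

/-- The optimal split of the surplus satisfies complementary slackness with some value of the
dual program at one click. -/
theorem exists_dual_value {lam₀ lam₁ S A B t₀ t₁ : ℝ} (h0 : 0 < lam₀) (h1 : 0 ≤ lam₁)
    (hS : 0 ≤ S) (hA : A = highMass lam₀ lam₁ S) (hAB : A + B = S)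
    (ht₀ : t₀ = B / (2 * lam₀ + B)) (ht₁ : t₁ = (lam₁ + A) / (2 * lam₁ + A)) :
    ∃ M v₁ : ℝ, 0 < M ∧ M = (1 - t₀) ^ 2 / 2 ∧
      (∀ y, 0 ≤ y → y ≤ 1 → y + (1 - 2 * y) * price M y ≤ v₁) ∧
      t₀ ^ 2 + M ≤ v₁ ∧ v₁ + M ≤ 1 ∧
      lam₀ * t₀ ^ 2 + lam₁ * v₁ + S * M = lam₀ * t₀ + lam₁ * t₁ := by
  have hA0 : 0 ≤ A := hA ▸ highMass_nonneg _ _ _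
  have hAS : A ≤ S := hA ▸ highMass_le h0 h1 hS
  have hB : 0 ≤ B := by linarith
  -- `b = 1 - t₀`, the point where `sub_price_le` is tight.
  obtain ⟨b, hb⟩ : ∃ b, b = 2 * lam₀ / (2 * lam₀ + B) := ⟨_, rfl⟩
  have hb0 : 0 < b := by rw [hb]; positivity
  have hb1 : b ≤ 1 := by rw [hb, div_le_one (by positivity)]; linarith
  have htb : t₀ = 1 - b := by rw [ht₀, hb]; field_simp; ring
  have hBb : B * b = 2 * lam₀ * (1 - b) := by rw [hb]; field_simp; ring
  have hs2 : Real.sqrt 2 ^ 2 = 2 := Real.sq_sqrt (by norm_num)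
  have hspos : 0 < Real.sqrt 2 := by positivity
  have hden : 0 < lam₁ + Real.sqrt 2 * lam₀ := by positivity
  rw [htb]
  -- Here `A = 0`, so `t₁ = 1/2` unless `λ₁ = 0`; at `y = 1/2` the one-click objective is 1/2
  -- whatever the price, so `v₁ = 1/2` is tight.
  by_cases hM : 1 / 4 ≤ b ^ 2 / 2 ∧ lam₁ * A = 0
  · obtain ⟨hM, hlA⟩ := hM
    have hA00 : A = 0 := by
      rcases mul_eq_zero.1 hlA with h | h
      · rw [hA, highMass, h]; simp
      · exact h
    have hl1 : lam₁ * t₁ = lam₁ / 2 := by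
      rcases h1.eq_or_lt with h | h
      · rw [← h]; simp
      · rw [ht₁, hA00]; field_simp; ring
    refine ⟨b ^ 2 / 2, 1 / 2, by positivity, by ring, fun y _ _ => add_price_le_half hM y,
      ?_, ?_, ?_⟩
    · nlinarith
    · nlinarith
    · rw [hl1]
      have hBS : B = S := by linarith
      rw [← hBS]
      linear_combination b / 2 * hBb
  -- Chosen so that `M = a²`. Tightness at one click asks for `t₁ = 1 - a`, which is the equation
  -- for `A * a` below.
  · obtain ⟨a, ha⟩ : ∃ a, a = b / Real.sqrt 2 := ⟨_, rfl⟩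
    have ha0 : 0 < a := by rw [ha]; positivity
    have haM : b ^ 2 / 2 = a ^ 2 := by rw [ha, div_pow, hs2]
    have hbs : b = Real.sqrt 2 * a := by rw [ha]; field_simp
    -- complementary slackness at one click
    have hslack : a ≤ 1 / 2 ∧ A * a = lam₁ * (1 - 2 * a) := by
      rcases le_or_gt ((lam₁ * S + 2 * lam₁ * lam₀ * (1 - Real.sqrt 2)) /
        (lam₁ + Real.sqrt 2 * lam₀)) 0 with hq | hq
      · have hA00 : A = 0 := by rw [hA, highMass, max_eq_right hq]
        have hM' : b ^ 2 / 2 < 1 / 4 := by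
          by_contra hc
          exact hM ⟨not_lt.1 hc, by rw [hA00, mul_zero]⟩
        have ha2 : a < 1 / 2 := by nlinarith
        refine ⟨ha2.le, ?_⟩
        have hnum : lam₁ * S + 2 * lam₁ * lam₀ * (1 - Real.sqrt 2) ≤ 0 := by
          by_contra hc
          exact absurd (div_pos (not_le.1 hc) hden) (not_lt.2 hq)
        rcases h1.eq_or_lt with h | h
        · rw [← h, hA00]; ring
        -- Truncation means that the surplus is too small for the ratio `√2`; this forces `a ≥ 1/2`,
        -- against `ha2`.
        · exfalso
          have hSle : S + 2 * lam₀ ≤ 2 * Real.sqrt 2 * lam₀ := by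
            have : lam₁ * (S + 2 * lam₀ - 2 * Real.sqrt 2 * lam₀) ≤ 0 := by linarith
            have := nonpos_of_mul_nonpos_right this h
            linarith
          have hBS : B = S := by linarith
          have h3 : (S + 2 * lam₀) * b = 2 * lam₀ := by rw [← hBS]; linarith
          have h4 := mul_le_mul_of_nonneg_right hSle hb0.le
          rw [h3, hbs] at h4
          have h5 : 2 * Real.sqrt 2 * lam₀ * (Real.sqrt 2 * a) = 4 * lam₀ * a := by
            linear_combination 2 * lam₀ * a * hs2
          rw [h5] at h4
          nlinarith
      · have hAq : A * (lam₁ + Real.sqrt 2 * lam₀)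
            = lam₁ * S + 2 * lam₁ * lam₀ * (1 - Real.sqrt 2) := by
          rw [hA, highMass, max_eq_left hq.le, div_mul_cancel₀ _ hden.ne']
        have hpos : 0 < lam₁ := by
          refine h1.lt_of_ne fun h => ?_
          rw [← h] at hq; simp at hq
        -- This is `1 - t₀ = √2 (1 - t₁)` with denominators cleared.
        have h6 : Real.sqrt 2 * lam₀ * (2 * lam₁ + A) = lam₁ * (2 * lam₀ + B) := by
          rw [← hAB] at hAq; linarith
        have h7 : (2 * lam₀ + B) * (Real.sqrt 2 * a) = 2 * lam₀ := by
          rw [← hbs]; linarith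
        have h8 : a * (2 * lam₁ + A) = lam₁ := by
          have : (2 * lam₀) * (a * (2 * lam₁ + A)) = 2 * lam₀ * lam₁ := by
            calc (2 * lam₀) * (a * (2 * lam₁ + A))
                = (Real.sqrt 2 ^ 2 * lam₀) * (a * (2 * lam₁ + A)) := by rw [hs2]
              _ = Real.sqrt 2 * a * (Real.sqrt 2 * lam₀ * (2 * lam₁ + A)) := by ring
              _ = lam₁ * ((2 * lam₀ + B) * (Real.sqrt 2 * a)) := by rw [h6]; ring
              _ = 2 * lam₀ * lam₁ := by rw [h7]; ring
          exact mul_left_cancel₀ (by positivity) this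
        refine ⟨?_, by linarith⟩
        have : 0 ≤ a * A := by positivity
        by_contra hc
        nlinarith
    obtain ⟨ha2, hAa⟩ := hslack
    have hl1 : lam₁ * t₁ = lam₁ * (1 - a) := by
      rcases h1.eq_or_lt with h | h
      · rw [← h]; simp
      · rw [ht₁, mul_div_assoc', div_eq_iff (by positivity)]
        linear_combination lam₁ * hAa
    have hab : a ≤ b := by
      have := Real.one_le_sqrt.2 (by norm_num : (1 : ℝ) ≤ 2)
      rw [hbs]; nlinarith
    refine ⟨b ^ 2 / 2, (1 - a) ^ 2 + a ^ 2, by positivity, by ring,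
      fun y _ _ => add_price_le_of_sq ha0 haM y, ?_, ?_, ?_⟩
    · rw [haM]
      have : (1 - b) ^ 2 ≤ (1 - a) ^ 2 := pow_le_pow_left₀ (by linarith) (by linarith) 2
      linarith
    · rw [haM]
      nlinarith
    · rw [hl1, ← hAB]
      have hB2 : B * (b ^ 2 / 2) = lam₀ * (1 - b) * b := by linear_combination b / 2 * hBb
      have hA2 : A * (b ^ 2 / 2) = lam₁ * (1 - 2 * a) * a := by
        rw [haM]; linear_combination a * hAa
      rw [add_mul, hA2, hB2]
      ring

theorem surplus_nonneg (hlam : IsSymmetricPrior lam) :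
    0 ≤ ∑ k ∈ Finset.Icc 2 n, ((k : ℝ) - 2) * levelMass lam k :=
  Finset.sum_nonneg fun k hk => mul_nonneg
    (sub_nonneg.2 (by exact_mod_cast (Finset.mem_Icc.1 hk).1)) (levelMass_nonneg hlam k)

/-- Splitting every `(k - 2) / k` in the same ratio `c : 1 - c` works. Positivity of `l n` needs
both `c < 1`, from `highMass_lt`, and `n ≥ 3`. -/
theorem exists_linSys (hn : 3 ≤ n) (hlam : IsSymmetricPrior lam) (h0 : 0 < levelMass lam 0) :
    ∃ h l : ℕ → ℝ, LinSys lam h l := by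
  set S := ∑ k ∈ Finset.Icc 2 n, ((k : ℝ) - 2) * levelMass lam k with hSdef
  have hS : 0 ≤ S := surplus_nonneg hlam
  obtain ⟨c, hc0, hc1, hcS⟩ : ∃ c : ℝ, 0 ≤ c ∧ c < 1 ∧
      c * S = highMass (levelMass lam 0) (levelMass lam 1) S := by
    rcases hS.eq_or_lt with h | h
    · refine ⟨0, le_rfl, one_pos, ?_⟩
      have h1 := highMass_le h0 (levelMass_nonneg hlam 1) hS
      have h2 := highMass_nonneg (levelMass lam 0) (levelMass lam 1) S
      linarith
    · have h1 := highMass_lt h0 (levelMass_nonneg hlam 1) h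
      exact ⟨_ / S, div_nonneg (highMass_nonneg _ _ _) hS, (div_lt_one h).2 h1,
        div_mul_cancel₀ _ h.ne'⟩
  have hfrac : ∀ k ∈ Finset.Icc 2 n, 0 ≤ ((k : ℝ) - 2) / k := fun k hk =>
    div_nonneg (sub_nonneg.2 (by exact_mod_cast (Finset.mem_Icc.1 hk).1)) (Nat.cast_nonneg k)
  have hsum : ∀ d : ℝ, ∑ k ∈ Finset.Icc 2 n, levelMass lam k * (k * (d * (((k : ℝ) - 2) / k)))
      = d * S := fun d => by
    rw [hSdef, Finset.mul_sum]
    refine Finset.sum_congr rfl fun k hk => ?_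
    have : (k : ℝ) ≠ 0 := Nat.cast_ne_zero.2 (by have := (Finset.mem_Icc.1 hk).1; omega)
    field_simp
  refine ⟨fun k => c * (((k : ℝ) - 2) / k), fun k => (1 - c) * (((k : ℝ) - 2) / k),
    ?_, ?_, ?_, ?_, ?_, ?_⟩
  · have : (3 : ℝ) ≤ n := by exact_mod_cast hn
    exact mul_pos (by linarith) (div_pos (by linarith) (by linarith))
  · exact fun k hk => mul_nonneg hc0 (hfrac k hk)
  · exact fun k hk => mul_nonneg (by linarith) (hfrac k hk)
  · intro k _; ring
  · rw [hsum, hcS]; rfl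
  · rw [hsum, hsum]; ring

/-- Every solution of the linear system yields an optimal signaling and the optimal value. -/
theorem LinSys.exists_optimal (hn : 3 ≤ n) (hlam : IsSymmetricPrior lam)
    (h0 : 0 < levelMass lam 0) {h l : ℕ → ℝ} (hsys : LinSys lam h l) :
    ∃ π : Signaling n, IsOptimalCalibrated lam π ∧
      revenue lam π = levelMass lam 0 * tZero lam l + levelMass lam 1 * tOne lam h
        + ∑ k ∈ Finset.Icc 2 n, levelMass lam k := by
  have : NeZero n := ⟨by omega⟩
  have hn2 : 2 ≤ n := by omega
  have h1 := levelMass_nonneg hlam 1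
  obtain ⟨A, hA⟩ : ∃ A, A = ∑ k ∈ Finset.Icc 2 n, levelMass lam k * (k * h k) := ⟨_, rfl⟩
  obtain ⟨B, hB⟩ : ∃ B, B = ∑ k ∈ Finset.Icc 2 n, levelMass lam k * (k * l k) := ⟨_, rfl⟩
  obtain ⟨S, hS⟩ : ∃ S, S = ∑ k ∈ Finset.Icc 2 n, ((k : ℝ) - 2) * levelMass lam k := ⟨_, rfl⟩
  have hS0 : 0 ≤ S := hS ▸ surplus_nonneg hlam
  have hAB : A + B = S := by rw [hA, hB, hS]; exact hsys.total_sum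
  have hAh : A = highMass (levelMass lam 0) (levelMass lam 1) S := by
    rw [hA, hS]; exact hsys.high_sum
  have hA0 : 0 ≤ A := hAh ▸ highMass_nonneg _ _ _
  have hAS : A ≤ S := hAh ▸ highMass_le h0 h1 hS0
  have hB0 : 0 ≤ B := by linarith
  have ht₀ : tZero lam l = B / (2 * levelMass lam 0 + B) := by rw [hB]; rfl
  have ht₁ : tOne lam h = (levelMass lam 1 + A) / (2 * levelMass lam 1 + A) := by rw [hA]; rfl
  have hm₀ : tZero lam l ∈ unitInterval := by
    rw [ht₀]
    exact ⟨by positivity, (div_le_one (by positivity)).2 (by linarith)⟩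
  have hm₁ : tOne lam h ∈ unitInterval := by
    rw [ht₁]
    exact ⟨by positivity, div_le_one_of_le₀ (by linarith) (by positivity)⟩
  obtain ⟨c, hc0, hc1, hcS⟩ : ∃ c : ℝ, 0 ≤ c ∧ c ≤ 1 ∧ c * S = A := by
    rcases hS0.eq_or_lt with h | h
    · exact ⟨0, le_rfl, zero_le_one, by linarith⟩
    · exact ⟨A / S, by positivity, (div_le_one h).2 hAS, div_mul_cancel₀ _ h.ne'⟩
  have hcal : IsCalibrated lam
      (twoLevelSignaling hn2 ⟨tZero lam l, hm₀⟩ ⟨tOne lam h, hm₁⟩ hc0 hc1) := by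
    refine isCalibrated_twoLevelSignaling hn2 hlam _ _ hc0 hc1 ?_ ?_
    · rw [← hS, hcS]
      change levelMass lam 1 * (1 - 2 * tOne lam h) + A * (1 - tOne lam h) = 0
      rcases (add_nonneg h1 hA0).eq_or_lt with h2 | h2
      -- The degenerate case, where `tOne` is `0 / 0`: both of its coefficients vanish.
      · have h3 : levelMass lam 1 = 0 := by linarith
        have h4 : A = 0 := by linarith
        rw [h3, h4]; ring
      · have h3 : 2 * levelMass lam 1 + A ≠ 0 := by linarith
        have h4 : tOne lam h * (2 * levelMass lam 1 + A) = levelMass lam 1 + A := by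
          rw [ht₁, div_mul_cancel₀ _ h3]
        linear_combination -h4
    · rw [← hS, sub_mul, hcS, one_mul, ← hAB]
      change (A + B - A) * (1 - tZero lam l) = levelMass lam 0 * (2 * tZero lam l)
      rw [ht₀]; field_simp; ring
  obtain ⟨M, v₁, hM, hMt, H1, H01, H12, hval⟩ :=
    exists_dual_value h0 h1 hS0 hAh hAB ht₀ ht₁
  -- `t₀ = 1` would make `M = (1 - t₀)² / 2` vanish.
  have hb : 0 < 1 - tZero lam l := by
    refine (sub_nonneg.2 hm₀.2).lt_of_ne fun h => ?_
    rw [hMt, ← h] at hM; simp at hM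
  have hupper : ∀ π : Signaling n, IsCalibrated lam π → revenue lam π ≤
      levelMass lam 0 * tZero lam l + levelMass lam 1 * tOne lam h
        + ∑ k ∈ Finset.Icc 2 n, levelMass lam k := fun π hπ => by
    have hle := hπ.revenue_le hn2 hlam hM (v₀ := tZero lam l ^ 2)
      (fun y _ _ => by simpa using sub_price_le hb hMt y) H1 H01 H12
    rw [sum_mul_dualValue (by omega), ← hS] at hle
    linarith
  have hlower := le_revenue_twoLevelSignaling hn2 hlam ⟨tZero lam l, hm₀⟩ ⟨tOne lam h, hm₁⟩
    hc0 hc1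
  rw [sum_mul_topSignal (by omega)] at hlower
  exact ⟨_, ⟨hcal, fun π' hπ' => (hupper π' hπ').trans hlower⟩,
    le_antisymm (hupper _ hcal) hlower⟩

theorem welfare_eq (hn : 1 ≤ n) (lam : Outcome n → ℝ) :
    welfare lam = levelMass lam 1 + ∑ k ∈ Finset.Icc 2 n, levelMass lam k := by
  have h : Finset.Icc 1 n = insert 1 (Finset.Icc 2 n) := by
    ext k; simp only [Finset.mem_insert, Finset.mem_Icc]; omega
  rw [welfare, h, Finset.sum_insert (by simp)]

end Main

end CalibratedSignaling

theorem mainTheorem2 (n : ℕ) (hn : 3 ≤ n) (lam : CalibratedSignaling.Outcome n → ℝ)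
    (hlam : CalibratedSignaling.IsSymmetricPrior lam)
    (h0 : 0 < CalibratedSignaling.levelMass lam 0) :
    (∃ π : CalibratedSignaling.Signaling n, CalibratedSignaling.IsOptimalCalibrated lam π) ∧
    (∃ h l : ℕ → ℝ, CalibratedSignaling.LinSys lam h l) ∧
    ∀ h l : ℕ → ℝ, CalibratedSignaling.LinSys lam h l →
    ∀ π : CalibratedSignaling.Signaling n, CalibratedSignaling.IsOptimalCalibrated lam π →
      CalibratedSignaling.revenue lam π =
          CalibratedSignaling.levelMass lam 0 * CalibratedSignaling.tZero lam l
          + CalibratedSignaling.levelMass lam 1 * CalibratedSignaling.tOne lam h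
          + ∑ k ∈ Finset.Icc 2 n, CalibratedSignaling.levelMass lam k ∧
      (CalibratedSignaling.tZero lam l ≤
          CalibratedSignaling.levelMass lam 1 * (1 - CalibratedSignaling.tOne lam h)
            / CalibratedSignaling.levelMass lam 0 →
        CalibratedSignaling.revenue lam π ≤ CalibratedSignaling.welfare lam ∧
        (CalibratedSignaling.revenue lam π = CalibratedSignaling.welfare lam ↔
          CalibratedSignaling.tZero lam l =
            CalibratedSignaling.levelMass lam 1 * (1 - CalibratedSignaling.tOne lam h)
              / CalibratedSignaling.levelMass lam 0)) ∧
      (CalibratedSignaling.levelMass lam 1 * (1 - CalibratedSignaling.tOne lam h)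
            / CalibratedSignaling.levelMass lam 0 < CalibratedSignaling.tZero lam l →
        CalibratedSignaling.welfare lam < CalibratedSignaling.revenue lam π) := by
  obtain ⟨h', l', hsys'⟩ := CalibratedSignaling.exists_linSys hn hlam h0
  obtain ⟨π₀, hπ₀, -⟩ := hsys'.exists_optimal hn hlam h0
  refine ⟨⟨π₀, hπ₀⟩, ⟨h', l', hsys'⟩, fun h l hsys π hπ => ?_⟩
  obtain ⟨π₁, hπ₁, hrev₁⟩ := hsys.exists_optimal hn hlam h0
  -- Optimal signalings all have the same revenue, so the constructed one determines the value.
  have hrev := (le_antisymm (hπ₁.2 π hπ.1) (hπ.2 π₁ hπ₁.1)).trans hrev₁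
  rw [le_div_iff₀ h0, eq_div_iff h0.ne', div_lt_iff₀ h0, hrev,
    CalibratedSignaling.welfare_eq (by omega) lam]
  refine ⟨rfl, fun ht => ⟨by linarith, fun he => by linarith, fun he => by linarith⟩,
    fun ht => by linarith⟩
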